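/- Let $E_0$ and $E_1$ be Banach spaces (both real or both complex) such that $E_1$ is densely and compactly embedded in $E_0$. Let $A$ be the generator of an analytic semigroup $(e^{tA})_{t\ge 0}$ on $E_0$ with domain $E_1$ (in the real case this means that the complexified semigroup is analytic). Let $T>0$, $a\in\mathbb{R}$, and $b\in C^1([0,T],\mathbb{R})$ with $b(0)\neq 0$, and set $$\Phi_T:=a\,e^{TA}+\int_0^T b(t)\,e^{tA}\,\mathrm{d}t .$$ If $\ker(\Phi_T)=\{0\}$, then $\Phi_T$ is an isomorphism from $E_0$ onto $E_1$; that is, $\Phi_T$ maps $E_0$ bijectively onto $E_1$, and $\Phi_T:E_0\to E_1$ and its inverse $E_1\to E_0$ are bounded with respect to the norms of $E_0$ and $E_1$. -/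

import Mathlib

open Set Filter Topology

universe u v

/-- `S` (only its values on `[0, ∞)` matter) is a strongly continuous semigroup of bounded
operators on `E`. -/
structure IsC0Semigroup {𝕜 : Type*} [RCLike 𝕜] {E : Type*} [NormedAddCommGroup E]
    [NormedSpace 𝕜 E] (S : ℝ → E →L[𝕜] E) : Prop where
  zero : S 0 = ContinuousLinearMap.id 𝕜 E
  add : ∀ s t : ℝ, 0 ≤ s → 0 ≤ t → S (s + t) = (S s).comp (S t)
  tendsto_zero : ∀ x : E, Tendsto (fun t : ℝ => S t x) (𝓝[>] 0) (𝓝 x)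

/-- The open sector `{z ≠ 0 : |arg z| < δ}`. -/
def openSector (δ : ℝ) : Set ℂ :=
  {z : ℂ | z ≠ 0 ∧ |Complex.arg z| < δ}

/-- `U` (only its values on `openSector δ ∪ {0}` matter) is an analytic semigroup of angle `δ` on
the complex space `F`. -/
structure IsHolomorphicSemigroup {F : Type*} [NormedAddCommGroup F] [NormedSpace ℂ F]
    (δ : ℝ) (U : ℂ → F →L[ℂ] F) : Prop where
  angle_pos : 0 < δ
  angle_le : δ ≤ Real.pi / 2
  zero : U 0 = ContinuousLinearMap.id ℂ F
  add : ∀ z ∈ openSector δ, ∀ w ∈ openSector δ, U (z + w) = (U z).comp (U w)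
  holomorphic : DifferentiableOn ℂ U (openSector δ)
  tendsto_zero : ∀ δ' : ℝ, 0 < δ' → δ' < δ → ∀ x : F,
    Tendsto (fun z : ℂ => U z x) (𝓝[openSector δ'] 0) (𝓝 x)

/-- `j : E → F` exhibits the complex normed space `F` as the scalar extension of `E` to `ℂ`.
If `𝕜 = ℂ`, then `RCLike.map 𝕜 ℂ` is the identity and `j` is a complex linear isometric
isomorphism (the clause `indep` is then automatic). If `𝕜 = ℝ`, then `(RCLike.I : 𝕜) = 0`, the
map `j` is a real linear isometry, and `F = j(E) ⊕ i j(E)`, i.e. `F` is a complexification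
of `E`. -/
structure IsComplexExtension (𝕜 : Type*) [RCLike 𝕜] {E F : Type*} [NormedAddCommGroup E]
    [NormedSpace 𝕜 E] [NormedAddCommGroup F] [NormedSpace ℂ F] (j : E → F) : Prop where
  map_add : ∀ x y : E, j (x + y) = j x + j y
  map_smul : ∀ (c : 𝕜) (x : E), j (c • x) = RCLike.map 𝕜 ℂ c • j x
  norm_map : ∀ x : E, ‖j x‖ = ‖x‖
  indep : ∀ x y : E, j x + Complex.I • j y = 0 → x + (RCLike.I : 𝕜) • y = 0
  span : ∀ z : F, ∃ x y : E, z = j x + Complex.I • j y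

/-- The semigroup `S` on the real or complex Banach space `E` is analytic: it (its
complexification, if the scalars are real) extends to an analytic semigroup on some sector. -/
def IsAnalyticSemigroup {𝕜 : Type*} [RCLike 𝕜] {E : Type u} [NormedAddCommGroup E]
    [NormedSpace 𝕜 E] (S : ℝ → E →L[𝕜] E) : Prop :=
  IsC0Semigroup S ∧
    ∃ (F : Type u) (_ : NormedAddCommGroup F) (_ : NormedSpace ℂ F) (_ : CompleteSpace F)
      (j : E → F) (δ : ℝ) (U : ℂ → F →L[ℂ] F),
      IsComplexExtension 𝕜 j ∧ IsHolomorphicSemigroup δ U ∧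
        ∀ t : ℝ, 0 ≤ t → ∀ x : E, j (S t x) = U (t : ℂ) (j x)

/-- `A`, regarded through the embedding `i : E₁ → E₀` as an operator in `E₀` with domain `E₁`,
is the infinitesimal generator of `S`: the limit of `(S h x - x) / h` as `h → 0+` exists and equals
`y` exactly when `x` is in the domain and is mapped to `y`. -/
def IsGeneratorWithDomain {𝕜 : Type*} [RCLike 𝕜] {E₀ E₁ : Type*}
    [NormedAddCommGroup E₀] [NormedSpace 𝕜 E₀] [NormedAddCommGroup E₁] [NormedSpace 𝕜 E₁]
    (i : E₁ →L[𝕜] E₀) (A : E₁ →ₗ[𝕜] E₀) (S : ℝ → E₀ →L[𝕜] E₀) : Prop :=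
  ∀ x y : E₀,
    Tendsto (fun h : ℝ => ((h⁻¹ : ℝ) : 𝕜) • (S h x - x)) (𝓝[>] 0) (𝓝 y) ↔
      ∃ u : E₁, i u = x ∧ A u = y

/-- The operator `a S(T) + ∫₀ᵀ b(t) S(t) dt`. -/
noncomputable def timeAverage {𝕜 : Type*} [RCLike 𝕜] {E : Type*} [NormedAddCommGroup E]
    [NormedSpace 𝕜 E] [NormedSpace ℝ E] [IsScalarTower ℝ 𝕜 E]
    (S : ℝ → E →L[𝕜] E) (a : ℝ) (b : ℝ → ℝ) (T : ℝ) : E →L[𝕜] E :=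
  a • S T + ∫ t in (0 : ℝ)..T, b t • S t

/-! ### Real scalars, complex extensions and norms of intertwined operators -/

/-! Formally, integration by parts gives `A Φ_T = a D + b(T) S(T) - b(0) - ∫ b' S`, where `D` is the
right derivative of `S` at `T`. Hence `(c - A) Φ_T = b(0) - K` for every real `c`, with `K = a D +
b(T) S(T) - ∫ b' S - c Φ_T`.

For `t > 0`, analyticity makes `S t` map into the domain, so `S t` factors through the compact
embedding. Norm limits and integrals preserve compactness, so `K` is compact. If `c` is not an
eigenvalue of `A`, then `b(0) - K` is injective because `Φ_T` is, hence surjective by the Fredholm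
alternative (`b(0) ≠ 0`). Injectivity of `c - A` then shows that `Φ_T` reaches every element of
`E₁`. The choice `c = ‖S 1‖` works: an eigenvector would satisfy `S 1 x = exp c • x`, but `exp c > c
= ‖S 1‖`.

The formula for `A Φ_T` is proved with difference quotients and the primitive `J t = ∫₀ᵗ S`, so no
bound on the derivative of `S` near `0` is needed. -/

theorem IsComplexExtension.map_sub {𝕜 E F : Type*} [RCLike 𝕜] [NormedAddCommGroup E]
    [NormedSpace 𝕜 E] [NormedAddCommGroup F] [NormedSpace ℂ F] {j : E → F}
    (hj : IsComplexExtension 𝕜 j) (x y : E) : j (x - y) = j x - j y := by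
  have h := hj.map_add (x - y) y
  rw [sub_add_cancel] at h
  rw [h, add_sub_cancel_right]

theorem IsComplexExtension.map_real_smul {𝕜 E F : Type*} [RCLike 𝕜] [NormedAddCommGroup E]
    [NormedSpace 𝕜 E] [NormedSpace ℝ E] [IsScalarTower ℝ 𝕜 E] [NormedAddCommGroup F]
    [NormedSpace ℂ F] {j : E → F} (hj : IsComplexExtension 𝕜 j) (r : ℝ) (x : E) :
    j (r • x) = r • j x := by
  rw [RCLike.real_smul_eq_coe_smul (K := 𝕜), hj.map_smul]
  simp [RCLike.map_apply]

/-- Transfers norm continuity and Cauchy estimates from the holomorphic `U` back to `S`. -/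
theorem IsComplexExtension.opNorm_le_of_intertwines {𝕜 E F : Type*} [RCLike 𝕜]
    [NormedAddCommGroup E] [NormedSpace 𝕜 E] [NormedAddCommGroup F] [NormedSpace ℂ F] {j : E → F}
    (hj : IsComplexExtension 𝕜 j) {P : E →L[𝕜] E} {Q : F →L[ℂ] F}
    (h : ∀ x, j (P x) = Q (j x)) : ‖P‖ ≤ ‖Q‖ :=
  P.opNorm_le_bound (norm_nonneg Q) fun x => by
    rw [← hj.norm_map, h, ← hj.norm_map x]
    exact Q.le_opNorm _

theorem ofReal_mem_openSector {δ t : ℝ} (hδ : 0 < δ) (ht : 0 < t) : (t : ℂ) ∈ openSector δ :=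
  ⟨by exact_mod_cast ht.ne', by rwa [Complex.arg_ofReal_of_nonneg ht.le, abs_zero]⟩

theorem IsHolomorphicSemigroup.hasDerivAt_ofReal {F : Type*} [NormedAddCommGroup F]
    [NormedSpace ℂ F] {δ : ℝ} {U : ℂ → F →L[ℂ] F} (hU : IsHolomorphicSemigroup δ U) {t : ℝ}
    (ht : 0 < t) : ∃ V, HasDerivAt (fun s : ℝ => U s) V t := by
  obtain ⟨V, hV⟩ :=
    (hU.holomorphic t (ofReal_mem_openSector hU.angle_pos ht))
  have h1 : HasDerivWithinAt (fun s : ℝ => U s) (V 1) (Ioi 0) t := by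
    have := (hV.restrictScalars ℝ).comp (s := Ioi 0) t
      (Complex.ofRealCLM.hasFDerivAt.hasFDerivWithinAt)
      (fun s hs => ofReal_mem_openSector hU.angle_pos hs)
    simpa [Function.comp_def] using this.hasDerivWithinAt
  exact ⟨_, h1.hasDerivAt (Ioi_mem_nhds ht)⟩

section Semigroup

variable {𝕜 : Type*} [RCLike 𝕜] {E : Type u} [NormedAddCommGroup E] [NormedSpace 𝕜 E]
  {S : ℝ → E →L[𝕜] E}

/-! ### Regularity of analytic semigroups -/

/-- Otherwise the norms would be unbounded along some `t n → 0+`, against uniform boundedness for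
the strongly convergent sequence `S (t n)`. -/
theorem IsC0Semigroup.exists_bound_near_zero [CompleteSpace E] (hS : IsC0Semigroup S) :
    ∃ ε > 0, ∃ M, ∀ t ∈ Ioo (0 : ℝ) ε, ‖S t‖ ≤ M := by
  by_contra! H
  choose t ht hM using fun n : ℕ => H (1 / ((n : ℝ) + 1)) Nat.one_div_pos_of_nat n
  have ht0 : Tendsto t atTop (𝓝[>] 0) := by
    refine tendsto_nhdsWithin_iff.2 ⟨?_, Eventually.of_forall fun n => (ht n).1⟩
    exact squeeze_zero (fun n => (ht n).1.le) (fun n => (ht n).2.le)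
      tendsto_one_div_add_atTop_nhds_zero_nat
  obtain ⟨C, hC⟩ := banach_steinhaus (g := fun n => S (t n)) fun x => by
    obtain ⟨C, hC⟩ := ((hS.tendsto_zero x).comp ht0).norm.bddAbove_range
    exact ⟨C, fun n => hC ⟨n, rfl⟩⟩
  obtain ⟨n, hn⟩ := exists_nat_gt C
  exact absurd (hC n) (not_le.2 (hn.trans (hM n)))

theorem IsAnalyticSemigroup.continuousOn_Ioi (hS : IsAnalyticSemigroup S) :
    ContinuousOn S (Ioi 0) := by
  obtain ⟨-, F, _, _, _, j, δ, U, hj, hU, hSU⟩ := hS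
  intro t ht
  obtain ⟨V, hV⟩ := hU.hasDerivAt_ofReal ht
  have hc : Tendsto (fun s : ℝ => ‖U s - U t‖) (𝓝[Ioi 0] t) (𝓝 0) :=
    (tendsto_iff_norm_sub_tendsto_zero.1 hV.continuousAt).mono_left nhdsWithin_le_nhds
  refine tendsto_iff_norm_sub_tendsto_zero.2
    (squeeze_zero' (Eventually.of_forall fun _ => norm_nonneg _) ?_ hc)
  filter_upwards [self_mem_nhdsWithin] with s hs
  refine hj.opNorm_le_of_intertwines fun x => ?_
  simp only [sub_apply, hj.map_sub]
  rw [hSU s (le_of_lt hs), hSU t (le_of_lt ht)]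

theorem IsAnalyticSemigroup.continuousOn_apply (hS : IsAnalyticSemigroup S) (x : E) :
    ContinuousOn (fun t => S t x) (Ici 0) := by
  intro t ht
  rcases eq_or_lt_of_le (mem_Ici.1 ht) with rfl | h
  · have h0 := hS.1.tendsto_zero x
    rw [← continuousWithinAt_Ioi_iff_Ici]
    simpa [ContinuousWithinAt, hS.1.zero] using h0
  · exact ((hS.continuousOn_Ioi.continuousAt (Ioi_mem_nhds h)).clm_apply
      continuousAt_const).continuousWithinAt

theorem IsAnalyticSemigroup.intervalIntegrable_zero [CompleteSpace E]
    (hS : IsAnalyticSemigroup S) {T : ℝ} (hT : 0 ≤ T) :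
    IntervalIntegrable S MeasureTheory.volume 0 T := by
  obtain ⟨ε, hε, M, hM⟩ := hS.1.exists_bound_near_zero
  obtain ⟨N, hN⟩ := (isCompact_Icc (a := ε) (b := T)).exists_bound_of_continuousOn
    (hS.continuousOn_Ioi.mono fun t ht => hε.trans_le ht.1)
  rw [intervalIntegrable_iff_integrableOn_Ioc_of_le hT]
  refine MeasureTheory.IntegrableOn.of_bound (C := max M N) measure_Ioc_lt_top
    ((hS.continuousOn_Ioi.mono fun t ht => ht.1).aestronglyMeasurable measurableSet_Ioc) ?_
  refine (MeasureTheory.ae_restrict_iff' measurableSet_Ioc).2 (Eventually.of_forall fun t ht => ?_)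
  rcases lt_or_ge t ε with h | h
  · exact (hM t ⟨ht.1, h⟩).trans (le_max_left _ _)
  · exact (hN t ⟨h, ht.2⟩).trans (le_max_right _ _)

variable [NormedSpace ℝ E] [IsScalarTower ℝ 𝕜 E]

/-- The derivative of `U` acts on `F` and would have to be descended to `E`. Instead the Cauchy
property of the quotients is transferred, and completeness supplies `D`. -/
theorem IsAnalyticSemigroup.exists_tendsto_slope [CompleteSpace E] (hS : IsAnalyticSemigroup S)
    {t : ℝ} (ht : 0 < t) :
    ∃ D : E →L[𝕜] E, Tendsto (fun h : ℝ => h⁻¹ • (S (t + h) - S t)) (𝓝[>] 0) (𝓝 D) := by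
  obtain ⟨-, F, _, _, _, j, δ, U, hj, hU, hSU⟩ := hS
  obtain ⟨V, hV⟩ := hU.hasDerivAt_ofReal ht
  have hc : Tendsto (fun h : ℝ => h⁻¹ • (U ((t + h : ℝ) : ℂ) - U t)) (𝓝[>] 0) (𝓝 V) :=
    hV.tendsto_slope_zero_right
  suffices H : Cauchy (map (fun h : ℝ => h⁻¹ • (S (t + h) - S t)) (𝓝[>] 0)) from
    CompleteSpace.complete H
  have hC := hc.cauchy_map
  rw [Metric.cauchy_iff] at hC ⊢
  refine ⟨inferInstance, fun ε hε => ?_⟩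
  obtain ⟨s, hs, hsε⟩ := hC.2 ε hε
  refine ⟨_, image_mem_map (inter_mem hs self_mem_nhdsWithin), ?_⟩
  rintro _ ⟨h, ⟨hh, hh0⟩, rfl⟩ _ ⟨k, ⟨hk, hk0⟩, rfl⟩
  refine lt_of_le_of_lt ?_ (hsε _ hh _ hk)
  rw [dist_eq_norm, dist_eq_norm]
  refine hj.opNorm_le_of_intertwines fun x => ?_
  have hh0 : 0 < h := hh0
  have hk0 : 0 < k := hk0
  simp only [sub_apply, smul_apply, hj.map_sub,
    hj.map_real_smul]
  rw [hSU t ht.le, hSU (t + h) (by positivity), hSU (t + k) (by positivity)]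

/-! ### The integrated semigroup -/

theorem IsAnalyticSemigroup.mul_integral [CompleteSpace E] (hS : IsAnalyticSemigroup S)
    {h t : ℝ} (hh : 0 ≤ h) (ht : 0 ≤ t) :
    S h * (∫ s in (0 : ℝ)..t, S s) = (∫ s in (0 : ℝ)..(h + t), S s) - ∫ s in (0 : ℝ)..h, S s := by
  have h1 := ((ContinuousLinearMap.mul 𝕜 (E →L[𝕜] E)) (S h)).intervalIntegral_comp_comm
    (hS.intervalIntegrable_zero ht)
  rw [ContinuousLinearMap.mul_apply'] at h1
  rw [← h1, intervalIntegral.integral_interval_sub_left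
    (hS.intervalIntegrable_zero (add_nonneg hh ht)) (hS.intervalIntegrable_zero hh)]
  have h2 := intervalIntegral.integral_comp_add_left (a := 0) (b := t) S h
  rw [add_zero] at h2
  rw [← h2]
  refine intervalIntegral.integral_congr fun s hs => ?_
  rw [uIcc_of_le ht] at hs
  exact (hS.1.add h s hh hs.1).symm

theorem IsAnalyticSemigroup.integral_mul [CompleteSpace E] (hS : IsAnalyticSemigroup S)
    {h t : ℝ} (hh : 0 ≤ h) (ht : 0 ≤ t) :
    (∫ s in (0 : ℝ)..h, S s) * S t = (∫ s in (0 : ℝ)..(h + t), S s) - ∫ s in (0 : ℝ)..t, S s := by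
  have h1 := ((ContinuousLinearMap.mul 𝕜 (E →L[𝕜] E)).flip (S t)).intervalIntegral_comp_comm
    (hS.intervalIntegrable_zero hh)
  rw [ContinuousLinearMap.flip_apply, ContinuousLinearMap.mul_apply'] at h1
  rw [← h1, intervalIntegral.integral_interval_sub_left
    (hS.intervalIntegrable_zero (add_nonneg hh ht)) (hS.intervalIntegrable_zero ht)]
  have h2 := intervalIntegral.integral_comp_add_right (a := 0) (b := h) S t
  rw [zero_add] at h2
  rw [← h2]
  refine intervalIntegral.integral_congr fun s hs => ?_
  rw [uIcc_of_le hh] at hs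
  exact (hS.1.add s t hs.1 ht).symm

/-- With `J t = ∫₀ᵗ S`, both sides equal `J (h + t) - J h - J t`. This moves the dependence on `h`
into the factor `J h`, which is easily divided by `h`. -/
theorem IsAnalyticSemigroup.sub_one_mul_integral [CompleteSpace E] (hS : IsAnalyticSemigroup S)
    {h t : ℝ} (hh : 0 ≤ h) (ht : 0 ≤ t) :
    (S h - 1) * (∫ s in (0 : ℝ)..t, S s) = (∫ s in (0 : ℝ)..h, S s) * (S t - 1) := by
  rw [sub_mul, mul_sub, one_mul, mul_one, hS.mul_integral hh ht, hS.integral_mul hh ht]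
  abel

theorem IsAnalyticSemigroup.tendsto_average [CompleteSpace E] (hS : IsAnalyticSemigroup S)
    (x : E) :
    Tendsto (fun h : ℝ => h⁻¹ • (∫ s in (0 : ℝ)..h, S s) x) (𝓝[>] 0) (𝓝 x) := by
  have hd : HasDerivWithinAt (fun h => ∫ s in (0 : ℝ)..h, S s x) (S 0 x) (Ici 0) 0 := by
    refine intervalIntegral.integral_hasDerivWithinAt_right (t := Ioi 0)
      IntervalIntegrable.refl ?_ ?_
    · exact ((hS.continuousOn_apply x).mono Ioi_subset_Ici_self).stronglyMeasurableAtFilter_nhdsWithin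
        measurableSet_Ioi _
    · exact (hS.continuousOn_apply x 0 self_mem_Ici).mono Ioi_subset_Ici_self
  have hd' := (hasDerivWithinAt_iff_tendsto_slope' self_notMem_Ioi).1
    (hd.mono Ioi_subset_Ici_self)
  simp only [hS.1.zero, ContinuousLinearMap.id_apply] at hd'
  refine hd'.congr' ?_
  filter_upwards [self_mem_nhdsWithin] with h hh
  rw [ContinuousLinearMap.intervalIntegral_apply (hS.intervalIntegrable_zero (le_of_lt hh)),
    slope_def_module]
  simp

theorem IsAnalyticSemigroup.hasDerivAt_integral [CompleteSpace E] (hS : IsAnalyticSemigroup S)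
    {t : ℝ} (ht : 0 < t) : HasDerivAt (fun r => ∫ s in (0 : ℝ)..r, S s) (S t) t :=
  intervalIntegral.integral_hasDerivAt_right (hS.intervalIntegrable_zero ht.le)
    (hS.continuousOn_Ioi.stronglyMeasurableAtFilter isOpen_Ioi t ht)
    (hS.continuousOn_Ioi.continuousAt (Ioi_mem_nhds ht))

/-! ### Eigenvectors of the generator -/

/-- The continuous function `exp (-c t) • S t x` has right derivative zero, so it is constant on
`[0, 1]`. -/
theorem IsAnalyticSemigroup.apply_one_eq_exp_smul (hS : IsAnalyticSemigroup S) {x : E} {c : ℝ}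
    (hx : Tendsto (fun h : ℝ => h⁻¹ • (S h x - x)) (𝓝[>] 0) (𝓝 (c • x))) :
    S 1 x = Real.exp c • x := by
  have hderiv : ∀ t ∈ Ico (0 : ℝ) 1,
      HasDerivWithinAt (fun t : ℝ => Real.exp (-c * t) • S t x) 0 (Ici t) t := by
    intro t ht
    have h1 : HasDerivWithinAt (fun t => S t x) (c • S t x) (Ici t) t := by
      rw [← hasDerivWithinAt_Ioi_iff_Ici, hasDerivWithinAt_iff_tendsto_slope' self_notMem_Ioi]
      have h2 := (S t).continuous.continuousAt.tendsto.comp hx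
      have h3 : Tendsto (fun s => s - t) (𝓝[>] t) (𝓝[>] 0) := by
        refine tendsto_nhdsWithin_iff.2 ⟨?_, ?_⟩
        · exact (((continuous_sub_right t).tendsto' t 0 (sub_self t))).mono_left nhdsWithin_le_nhds
        · filter_upwards [self_mem_nhdsWithin] with s hs using sub_pos.2 (mem_Ioi.1 hs)
      have h4 := h2.comp h3
      rw [(S t).map_smul_of_tower] at h4
      refine h4.congr' ?_
      filter_upwards [self_mem_nhdsWithin] with s hs
      have h5 := hS.1.add t (s - t) ht.1 (sub_pos.2 (mem_Ioi.1 hs)).le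
      rw [add_sub_cancel] at h5
      simp only [Function.comp_apply, slope_def_module]
      rw [(S t).map_smul_of_tower, map_sub, h5]
      rfl
    have h6 : HasDerivWithinAt (fun t : ℝ => Real.exp (-c * t)) 
        (Real.exp (-c * t) * -c) (Ici t) t := by
      simpa using (((hasDerivAt_id t).const_mul (-c)).exp).hasDerivWithinAt
    have h7 := h6.fun_smul h1
    rwa [smul_smul, ← add_smul, mul_neg, add_neg_cancel, zero_smul] at h7
  have hcont : ContinuousOn (fun t : ℝ => Real.exp (-c * t) • S t x) (Icc 0 1) :=
    (by fun_prop : Continuous fun t : ℝ => Real.exp (-c * t)).continuousOn.smul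
      ((hS.continuousOn_apply x).mono Icc_subset_Ici_self)
  have h := constant_of_has_deriv_right_zero hcont hderiv 1 (right_mem_Icc.2 zero_le_one)
  simp only [mul_one, mul_zero, Real.exp_zero, one_smul, hS.1.zero,
    ContinuousLinearMap.id_apply] at h
  nth_rw 2 [← h]
  rw [smul_smul, ← Real.exp_add]
  simp

theorem IsAnalyticSemigroup.eq_zero_of_tendsto_norm_smul (hS : IsAnalyticSemigroup S) {x : E}
    (hx : Tendsto (fun h : ℝ => h⁻¹ • (S h x - x)) (𝓝[>] 0) (𝓝 (‖S 1‖ • x))) : x = 0 := by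
  have h1 := (S 1).le_opNorm x
  rw [hS.apply_one_eq_exp_smul hx, norm_smul, Real.norm_of_nonneg (Real.exp_nonneg _)] at h1
  have h2 := Real.add_one_le_exp ‖S 1‖
  have h3 : ‖x‖ ≤ 0 := by nlinarith [norm_nonneg x]
  exact norm_le_zero_iff.1 h3

end Semigroup

/-! ### Operators with values in an embedded space -/

/-- Closed graph theorem: continuity of `B` and `i` with injectivity of `i` closes the graph of the
lift. -/
theorem ContinuousLinearMap.exists_comp_eq_of_forall_mem_range {𝕜 E F G : Type*}
    [NontriviallyNormedField 𝕜] [NormedAddCommGroup E] [NormedSpace 𝕜 E] [CompleteSpace E]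
    [NormedAddCommGroup F] [NormedSpace 𝕜 F] [CompleteSpace F] [NormedAddCommGroup G]
    [NormedSpace 𝕜 G] (i : F →L[𝕜] G) (hi : Function.Injective i) (B : E →L[𝕜] G)
    (h : ∀ x, ∃ u, i u = B x) : ∃ C : E →L[𝕜] F, i.comp C = B := by
  choose f hf using h
  let g : E →ₗ[𝕜] F :=
    { toFun := f
      map_add' := fun x y => hi (by simp [hf])
      map_smul' := fun c x => hi (by simp [hf]) }
  have hg : ∀ x, i (g x) = B x := hf
  refine ⟨ContinuousLinearMap.ofSeqClosedGraph (g := g) fun s x y hs hgs => hi ?_,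
    ContinuousLinearMap.ext hg⟩
  have h1 := (i.continuous.tendsto y).comp hgs
  have h2 : Tendsto (fun n => i (g (s n))) atTop (𝓝 (i (g x))) := by
    simp only [hg]
    exact (B.continuous.tendsto x).comp hs
  exact tendsto_nhds_unique h1 h2

/-! ### Compact operators -/

/-- Compact operators form a closed convex set, which therefore contains the average of `f`. -/
theorem isCompactOperator_intervalIntegral {𝕜 : Type*} [RCLike 𝕜] {E F : Type*}
    [NormedAddCommGroup E] [NormedSpace 𝕜 E] [NormedAddCommGroup F] [NormedSpace 𝕜 F]
    [CompleteSpace F] [NormedSpace ℝ F] [IsScalarTower ℝ 𝕜 F] {f : ℝ → E →L[𝕜] F} {a b : ℝ}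
    (hab : a ≤ b) (hf : IntervalIntegrable f MeasureTheory.volume a b)
    (hc : ∀ t ∈ Ioc a b, IsCompactOperator (f t)) :
    IsCompactOperator (∫ t in a..b, f t : E →L[𝕜] F) := by
  rcases eq_or_lt_of_le hab with rfl | hlt
  · simpa using isCompactOperator_zero
  have hconv : Convex ℝ {B : E →L[𝕜] F | IsCompactOperator B} := by
    intro B hB C hC r s _ _ _
    exact (hB.smul r).add (hC.smul s)
  have hmem := hconv.set_average_mem (μ := MeasureTheory.volume) (t := Ioc a b) (f := f)
    isClosed_setOfPred_isCompactOperator (by simp [hlt]) (by simp)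
    ((MeasureTheory.ae_restrict_iff' measurableSet_Ioc).2 (Eventually.of_forall hc))
    ((intervalIntegrable_iff_integrableOn_Ioc_of_le hab).1 hf)
  have heq : (∫ t in a..b, f t) = (b - a) • ⨍ t in Ioc a b, f t := by
    rw [MeasureTheory.setAverage_eq, intervalIntegral.integral_of_le hab, smul_smul]
    simp [MeasureTheory.measureReal_def, hab, (sub_pos.2 hlt).ne']
  rw [heq]
  exact IsCompactOperator.smul hmem (b - a)

theorem IsCompactOperator.surjective_smul_one_sub_of_injective {𝕜 E : Type*}
    [NontriviallyNormedField 𝕜] [NormedAddCommGroup E] [NormedSpace 𝕜 E] [CompleteSpace E]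
    {K : E →L[𝕜] E} (hK : IsCompactOperator K) {c : 𝕜} (hc : c ≠ 0)
    (hinj : ∀ x, c • x = K x → x = 0) (y : E) : ∃ x, c • x - K x = y := by
  rcases hK.hasEigenvalue_or_mem_resolventSet hc with h | h
  · obtain ⟨x, hx⟩ := h.exists_hasEigenvector
    exact absurd (hinj x hx.apply_eq_smul.symm) hx.2
  · obtain ⟨u, hu⟩ := h
    refine ⟨(↑u⁻¹ : E →L[𝕜] E) y, ?_⟩
    have h1 := DFunLike.congr_fun u.mul_inv y
    rw [hu] at h1
    simpa [Algebra.algebraMap_eq_smul_one] using h1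

/-! ### The time average and the generator -/

section TimeAverage

variable {𝕜 : Type*} [RCLike 𝕜] {E : Type u} [NormedAddCommGroup E] [NormedSpace 𝕜 E]
  [NormedSpace ℝ E] [IsScalarTower ℝ 𝕜 E] [CompleteSpace E] {S : ℝ → E →L[𝕜] E}

theorem IsAnalyticSemigroup.integral_smul_eq (hS : IsAnalyticSemigroup S) {T : ℝ} (hT : 0 < T)
    {b : ℝ → ℝ} (hb : ContDiffOn ℝ 1 b (Icc 0 T)) :
    ∫ t in (0 : ℝ)..T, b t • S t = b T • (∫ s in (0 : ℝ)..T, S s) -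
      ∫ t in (0 : ℝ)..T, derivWithin b (Icc 0 T) t • ∫ s in (0 : ℝ)..t, S s := by
  have hc : ContinuousOn (derivWithin b (Icc 0 T)) (uIcc 0 T) := by
    rw [uIcc_of_le hT.le]
    exact hb.continuousOn_derivWithin (uniqueDiffOn_Icc hT) le_rfl
  have hJ : ContinuousOn (fun r => ∫ s in (0 : ℝ)..r, S s) (uIcc 0 T) :=
    intervalIntegral.continuousOn_primitive_interval'
      (hS.intervalIntegrable_zero hT.le) left_mem_uIcc
  have h := intervalIntegral.integral_smul_deriv_eq_deriv_smul_of_hasDerivAt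
    (u := b) (u' := derivWithin b (Icc 0 T)) (by rw [uIcc_of_le hT.le]; exact hb.continuousOn) hJ
    (fun t ht => ?_) (fun t ht => hS.hasDerivAt_integral ?_) hc.intervalIntegrable
    (hS.intervalIntegrable_zero hT.le)
  · simpa using h
  · rw [min_eq_left hT.le, max_eq_right hT.le] at ht
    exact ((hb.differentiableOn one_ne_zero) t (Ioo_subset_Icc_self ht)).hasDerivWithinAt.hasDerivAt
      (Icc_mem_nhds ht.1 ht.2)
  · rw [min_eq_left hT.le] at ht
    exact ht.1

/-- Integrated form of the formula for `A Φ_T`: after division by `h`, the factor `∫₀ʰ S` tends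
strongly to the identity. -/
theorem IsAnalyticSemigroup.sub_one_mul_timeAverage (hS : IsAnalyticSemigroup S) {T : ℝ}
    (hT : 0 < T) (a : ℝ) {b : ℝ → ℝ} (hb : ContDiffOn ℝ 1 b (Icc 0 T)) {h : ℝ} (hh : 0 ≤ h) :
    (S h - 1) * timeAverage S a b T = a • (S (T + h) - S T) +
      (∫ s in (0 : ℝ)..h, S s) * (b T • S T - b 0 • 1 -
        ∫ t in (0 : ℝ)..T, derivWithin b (Icc 0 T) t • S t) := by
  set β := derivWithin b (Icc 0 T)
  set J : ℝ → E →L[𝕜] E := fun t => ∫ s in (0 : ℝ)..t, S s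
  have hc : ContinuousOn β (uIcc 0 T) := by
    rw [uIcc_of_le hT.le]
    exact hb.continuousOn_derivWithin (uniqueDiffOn_Icc hT) le_rfl
  have hJ : ContinuousOn J (uIcc 0 T) :=
    intervalIntegral.continuousOn_primitive_interval'
      (hS.intervalIntegrable_zero hT.le) left_mem_uIcc
  have hβS : IntervalIntegrable (fun t => β t • S t) MeasureTheory.volume 0 T :=
    (hS.intervalIntegrable_zero hT.le).continuousOn_smul hc
  have hβ1 : IntervalIntegrable (fun t => β t • (1 : E →L[𝕜] E)) MeasureTheory.volume 0 T :=
    (hc.smul continuousOn_const).intervalIntegrable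
  have hint : ∫ t in (0 : ℝ)..T, β t = b T - b 0 :=
    intervalIntegral.integral_eq_sub_of_hasDerivAt_of_le hT.le hb.continuousOn (fun t ht =>
      ((hb.differentiableOn one_ne_zero) t (Ioo_subset_Icc_self ht)).hasDerivWithinAt.hasDerivAt
        (Icc_mem_nhds ht.1 ht.2)) hc.intervalIntegrable
  -- Writing `b 0` as `b T - ∫ β` produces the factors `S t - 1` that `sub_one_mul_integral` yields.
  have hright : b T • S T - b 0 • 1 - ∫ t in (0 : ℝ)..T, β t • S t =
      b T • (S T - 1) - ∫ t in (0 : ℝ)..T, β t • (S t - 1) := by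
    simp only [smul_sub]
    rw [intervalIntegral.integral_sub hβS hβ1, intervalIntegral.integral_smul_const, hint,
      sub_smul]
    abel
  have hpull : (S h - 1) * ∫ t in (0 : ℝ)..T, β t • J t =
      J h * ∫ t in (0 : ℝ)..T, β t • (S t - 1) := by
    have h1 := ((ContinuousLinearMap.mul 𝕜 (E →L[𝕜] E)) (S h - 1)).intervalIntegral_comp_comm
      (μ := MeasureTheory.volume) (hc.smul hJ).intervalIntegrable
    have h2 := ((ContinuousLinearMap.mul 𝕜 (E →L[𝕜] E)) (J h)).intervalIntegral_comp_comm
      (f := fun t => β t • (S t - 1)) (by simpa only [smul_sub] using hβS.sub hβ1)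
    simp only [ContinuousLinearMap.mul_apply', Pi.smul_apply'] at h1 h2
    rw [← h1, ← h2]
    refine intervalIntegral.integral_congr fun t ht => ?_
    rw [uIcc_of_le hT.le] at ht
    simp only [mul_smul_comm]
    rw [hS.sub_one_mul_integral hh ht.1]
  have hshift : (S h - 1) * S T = S (T + h) - S T := by
    rw [sub_mul, one_mul, add_comm, hS.1.add h T hh hT.le]
    rfl
  rw [timeAverage, hS.integral_smul_eq hT hb, hright, mul_add, mul_sub, mul_sub, hpull,
    mul_smul_comm, mul_smul_comm, mul_smul_comm, hshift, hS.sub_one_mul_integral hh hT.le]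

theorem IsAnalyticSemigroup.tendsto_slope_timeAverage (hS : IsAnalyticSemigroup S) {T : ℝ}
    (hT : 0 < T) (a : ℝ) {b : ℝ → ℝ} (hb : ContDiffOn ℝ 1 b (Icc 0 T)) {D : E →L[𝕜] E}
    (hD : Tendsto (fun h : ℝ => h⁻¹ • (S (T + h) - S T)) (𝓝[>] 0) (𝓝 D)) (x : E) :
    Tendsto (fun h : ℝ => h⁻¹ • (S h (timeAverage S a b T x) - timeAverage S a b T x))
      (𝓝[>] 0) (𝓝 ((a • D + (b T • S T - b 0 • 1 -
        ∫ t in (0 : ℝ)..T, derivWithin b (Icc 0 T) t • S t)) x)) := by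
  set R := b T • S T - b 0 • 1 - ∫ t in (0 : ℝ)..T, derivWithin b (Icc 0 T) t • S t with hR
  have h1 : Tendsto (fun h : ℝ => a • (h⁻¹ • (S (T + h) - S T)) x) (𝓝[>] 0) (𝓝 (a • D x)) :=
    (((ContinuousLinearMap.apply 𝕜 E x).continuous.tendsto D).comp hD).const_smul a
  refine (h1.add (hS.tendsto_average (R x))).congr' ?_
  filter_upwards [self_mem_nhdsWithin] with h hh
  have h2 := DFunLike.congr_fun (hS.sub_one_mul_timeAverage hT a hb (le_of_lt hh)) x
  rw [← hR] at h2
  simp only [mul_apply_eq_comp, sub_apply, add_apply, smul_apply,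
    one_apply_eq_self] at h2 ⊢
  rw [h2, smul_add, smul_comm a]

end TimeAverage

theorem IsGeneratorWithDomain.tendsto_iff {𝕜 : Type*} [RCLike 𝕜] {E₀ E₁ : Type*}
    [NormedAddCommGroup E₀] [NormedSpace 𝕜 E₀] [NormedSpace ℝ E₀] [IsScalarTower ℝ 𝕜 E₀]
    [NormedAddCommGroup E₁] [NormedSpace 𝕜 E₁] {i : E₁ →L[𝕜] E₀} {A : E₁ →ₗ[𝕜] E₀}
    {S : ℝ → E₀ →L[𝕜] E₀} (hA : IsGeneratorWithDomain i A S) (x y : E₀) :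
    Tendsto (fun h : ℝ => h⁻¹ • (S h x - x)) (𝓝[>] 0) (𝓝 y) ↔ ∃ u : E₁, i u = x ∧ A u = y := by
  simp only [RCLike.real_smul_eq_coe_smul (K := 𝕜)]
  exact hA x y

/-! ### ### Compactness from the embedded domain -/

section Domain

variable {𝕜 : Type*} [RCLike 𝕜] {E₀ : Type u} [NormedAddCommGroup E₀] [NormedSpace 𝕜 E₀]
  [CompleteSpace E₀] [NormedSpace ℝ E₀] [IsScalarTower ℝ 𝕜 E₀] {E₁ : Type v}
  [NormedAddCommGroup E₁] [NormedSpace 𝕜 E₁] {i : E₁ →L[𝕜] E₀}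
  {A : E₁ →ₗ[𝕜] E₀} {S : ℝ → E₀ →L[𝕜] E₀}

/-- Differentiability at `t` puts `S t x` in the domain of the generator, so `S t` factors boundedly
through `i`. -/
theorem IsAnalyticSemigroup.isCompactOperator [CompleteSpace E₁] (hS : IsAnalyticSemigroup S)
    (hA : IsGeneratorWithDomain i A S) (hi_inj : Function.Injective i)
    (hi_compact : IsCompactOperator i) {t : ℝ} (ht : 0 < t) : IsCompactOperator (S t) := by
  obtain ⟨D, hD⟩ := hS.exists_tendsto_slope ht
  have hmem : ∀ x, ∃ u, i u = S t x := fun x => by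
    have h1 : Tendsto (fun h : ℝ => h⁻¹ • (S h (S t x) - S t x)) (𝓝[>] 0) (𝓝 (D x)) := by
      refine (((ContinuousLinearMap.apply 𝕜 E₀ x).continuous.tendsto D).comp hD).congr' ?_
      filter_upwards [self_mem_nhdsWithin] with h hh
      have h2 := DFunLike.congr_fun (hS.1.add h t (le_of_lt hh) ht.le) x
      rw [add_comm] at h2
      simp [h2]
    obtain ⟨u, hu, -⟩ := (hA.tendsto_iff _ _).1 h1
    exact ⟨u, hu⟩
  obtain ⟨C, hC⟩ := i.exists_comp_eq_of_forall_mem_range hi_inj (S t) hmem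
  rw [← hC]
  exact hi_compact.comp_clm C

theorem IsAnalyticSemigroup.isCompactOperator_of_tendsto_slope [CompleteSpace E₁]
    (hS : IsAnalyticSemigroup S)
    (hA : IsGeneratorWithDomain i A S) (hi_inj : Function.Injective i)
    (hi_compact : IsCompactOperator i) {t : ℝ} (ht : 0 < t) {D : E₀ →L[𝕜] E₀}
    (hD : Tendsto (fun h : ℝ => h⁻¹ • (S (t + h) - S t)) (𝓝[>] 0) (𝓝 D)) :
    IsCompactOperator D := by
  refine isClosed_setOfPred_isCompactOperator.mem_of_tendsto hD ?_
  filter_upwards [self_mem_nhdsWithin] with h hh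
  exact ((hS.isCompactOperator hA hi_inj hi_compact (add_pos ht hh)).sub
    (hS.isCompactOperator hA hi_inj hi_compact ht)).smul h⁻¹

end Domain

/-! ### ### The isomorphism -/

theorem proposition1 {𝕜 : Type*} [RCLike 𝕜]
    {E₀ : Type u} [NormedAddCommGroup E₀] [NormedSpace 𝕜 E₀] [CompleteSpace E₀]
    [NormedSpace ℝ E₀] [IsScalarTower ℝ 𝕜 E₀]
    {E₁ : Type v} [NormedAddCommGroup E₁] [NormedSpace 𝕜 E₁] [CompleteSpace E₁]
    (i : E₁ →L[𝕜] E₀) (hi_inj : Function.Injective i) (hi_dense : DenseRange i)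
    (hi_compact : IsCompactOperator i)
    (A : E₁ →ₗ[𝕜] E₀) (S : ℝ → E₀ →L[𝕜] E₀)
    (hS : IsAnalyticSemigroup S) (hA : IsGeneratorWithDomain i A S)
    (T : ℝ) (hT : 0 < T) (a : ℝ) (b : ℝ → ℝ) (hb : ContDiffOn ℝ 1 b (Set.Icc 0 T))
    (hb0 : b 0 ≠ 0)
    (hker : LinearMap.ker (timeAverage S a b T).toLinearMap = ⊥) :
    ∃ Φ : E₀ ≃L[𝕜] E₁, i.comp (Φ : E₀ →L[𝕜] E₁) = timeAverage S a b T := by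
  obtain ⟨D, hD⟩ := hS.exists_tendsto_slope hT
  have hScomp : ∀ t, 0 < t → IsCompactOperator (S t) :=
    fun t ht => hS.isCompactOperator hA hi_inj hi_compact ht
  have hinj : ∀ x, timeAverage S a b T x = 0 → x = 0 := fun x hx => by
    rw [← Submodule.mem_bot 𝕜, ← hker]
    exact hx
  have hslope := hS.tendsto_slope_timeAverage hT a hb hD
  have hbc : ContinuousOn b (uIcc 0 T) := by
    rw [uIcc_of_le hT.le]
    exact hb.continuousOn
  have hβ : ContinuousOn (derivWithin b (Icc 0 T)) (uIcc 0 T) := by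
    rw [uIcc_of_le hT.le]
    exact hb.continuousOn_derivWithin (uniqueDiffOn_Icc hT) le_rfl
  set Q := ∫ t in (0 : ℝ)..T, derivWithin b (Icc 0 T) t • S t
  have hQcomp : IsCompactOperator Q :=
    isCompactOperator_intervalIntegral hT.le
      ((hS.intervalIntegrable_zero hT.le).continuousOn_smul hβ)
      fun t ht => (hScomp t ht.1).smul _
  have hΦcomp : IsCompactOperator (timeAverage S a b T) :=
    ((hScomp T hT).smul a).add (isCompactOperator_intervalIntegral hT.le
      ((hS.intervalIntegrable_zero hT.le).continuousOn_smul hbc)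
      fun t ht => (hScomp t ht.1).smul _)
  have hDcomp : IsCompactOperator D :=
    hS.isCompactOperator_of_tendsto_slope hA hi_inj hi_compact hT hD
  -- `b(0) - K` is `(c - A) Φ_T` with `c = ‖S 1‖`, which is not an eigenvalue of `A`.
  let K : E₀ →L[𝕜] E₀ := a • D + b T • S T - Q - ‖S 1‖ • timeAverage S a b T
  have hK : IsCompactOperator K :=
    (((hDcomp.smul a).add ((hScomp T hT).smul (b T))).sub hQcomp).sub (hΦcomp.smul ‖S 1‖)
  obtain ⟨C, hC⟩ := i.exists_comp_eq_of_forall_mem_range hi_inj (timeAverage S a b T) fun x => by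
    obtain ⟨u, hu, -⟩ := (hA.tendsto_iff _ _).1 (hslope x)
    exact ⟨u, hu⟩
  have hiC : ∀ x, i (C x) = timeAverage S a b T x := fun x => DFunLike.congr_fun hC x
  have hAC : ∀ x, ((b 0 : ℝ) : 𝕜) • x - K x = ‖S 1‖ • i (C x) - A (C x) := fun x => by
    obtain ⟨u, hu, hu'⟩ := (hA.tendsto_iff _ _).1 (hslope x)
    rw [← hiC x] at hu
    rw [← hi_inj hu, hu', hi_inj hu, hiC, ← RCLike.real_smul_eq_coe_smul (K := 𝕜)]
    simp only [K, sub_apply, add_apply, smul_apply, one_apply_eq_self]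
    abel
  have heig : ∀ u, ‖S 1‖ • i u = A u → u = 0 := fun u hu => by
    refine hi_inj ?_
    rw [map_zero]
    exact hS.eq_zero_of_tendsto_norm_smul ((hA.tendsto_iff _ _).2 ⟨u, rfl, hu.symm⟩)
  have hCinj : ∀ x, C x = 0 → x = 0 := fun x hx => hinj x (by rw [← hiC, hx, map_zero])
  have hb0' : ((b 0 : ℝ) : 𝕜) ≠ 0 := by exact_mod_cast hb0
  -- Solve `(b(0) - K) x = (c - A) u`, that is `(c - A) (C x) = (c - A) u`, and cancel `c - A`; its
  -- surjectivity is not needed.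
  have hCsurj : Function.Surjective C := fun u => by
    obtain ⟨x, hx⟩ := hK.surjective_smul_one_sub_of_injective hb0'
      (fun x hx => hCinj x (heig _ (sub_eq_zero.1 (by rw [← hAC, hx, sub_self]))))
      (‖S 1‖ • i u - A u)
    refine ⟨x, sub_eq_zero.1 (heig _ (sub_eq_zero.1 ?_))⟩
    rw [hAC] at hx
    rw [map_sub, map_sub, smul_sub, sub_sub_sub_comm, hx, sub_self]
  refine ⟨ContinuousLinearEquiv.ofBijective C ?_ ?_, ?_⟩
  · exact LinearMap.ker_eq_bot'.2 hCinj
  · exact LinearMap.range_eq_top.2 hCsurj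
  · rw [ContinuousLinearEquiv.coe_ofBijective, hC]
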